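/- Let $0\le a<b\le+\infty$ with $a$ finite, let $g:(a,b)\to\mathbb R$ be a real-valued function, and let $N\ge2$ be an integer. Suppose that $g$ is an anti-Löwner function of order $2N$ on $(a,b)$, that is, for all distinct $x_1,\dots,x_{2N}\in(a,b)$ the $2N\times2N$ matrix $\left(\frac{g(x_i)+g(x_j)}{x_i+x_j}\right)_{i,j=1}^{2N}$ is positive semidefinite. Then (with $b^2=+\infty$ if $b=+\infty$) the function $x\mapsto \sqrt{x}\,g(\sqrt{x})$ is a non-negative matrix monotone function of order $N$ on $(a^2,b^2)$, and the function $x\mapsto g(\sqrt{x})/\sqrt{x}$ is a non-negative matrix monotone decreasing function of order $N$ on $(a^2,b^2)$. Here a real-valued function $f$ on an interval $I$ is called matrix monotone (respectively matrix monotone decreasing) of order $N$ on $I$ if for all complex Hermitian $N\times N$ matrices $A,B$ with spectrum in $I$, $A\le B$ implies $f(A)\le f(B)$ (respectively $f(A)\ge f(B)$), where $\le$ is the positive semidefinite ordering and $f(A)$ is defined by the spectral functional calculus. -/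

import Mathlib

open scoped ComplexOrder

/-- The real open interval `(a, b)` with a finite left endpoint `a` and a right endpoint `b` that is
allowed to be `+∞`. -/
def openInterval (a : ℝ) (b : EReal) : Set ℝ :=
  {x : ℝ | a < x ∧ (x : EReal) < b}

/-- The anti-Löwner matrix `((g (x i) + g (x j)) / (x i + x j))` of `g` at the points `x i`. -/
noncomputable def antiLoewnerMatrix {n : ℕ} (g : ℝ → ℝ) (x : Fin n → ℝ) :
    Matrix (Fin n) (Fin n) ℝ :=
  Matrix.of fun i j => (g (x i) + g (x j)) / (x i + x j)

/-- `g` is an anti-Löwner function of order `n` on `I`: all its `n × n` anti-Löwner matrices at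
distinct points of `I` are positive semidefinite. -/
def IsAntiLoewnerOn (n : ℕ) (g : ℝ → ℝ) (I : Set ℝ) : Prop :=
  ∀ x : Fin n → ℝ, (∀ i, x i ∈ I) → Function.Injective x → (antiLoewnerMatrix g x).PosSemidef

/-- `f` is matrix monotone of order `n` on `I`: for all complex Hermitian `n × n` matrices `A`, `B`
with spectrum in `I`, if `B - A` is positive semidefinite then so is `f(B) - f(A)`. Since the spectrum
of a matrix is finite, `cfc f` is the spectral functional calculus for an arbitrary `f`. -/
def IsMatrixMonotoneOn (n : ℕ) (f : ℝ → ℝ) (I : Set ℝ) : Prop :=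
  ∀ A B : Matrix (Fin n) (Fin n) ℂ, A.IsHermitian → B.IsHermitian →
    spectrum ℝ A ⊆ I → spectrum ℝ B ⊆ I →
    (B - A).PosSemidef → (cfc f B - cfc f A).PosSemidef

/-- `f` is matrix monotone decreasing of order `n` on `I`: for all complex Hermitian `n × n`
matrices `A`, `B` with spectrum in `I`, if `B - A` is positive semidefinite then so is
`f(A) - f(B)`. -/
def IsMatrixAntitoneOn (n : ℕ) (f : ℝ → ℝ) (I : Set ℝ) : Prop :=
  ∀ A B : Matrix (Fin n) (Fin n) ℂ, A.IsHermitian → B.IsHermitian →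
    spectrum ℝ A ⊆ I → spectrum ℝ B ⊆ I →
    (B - A).PosSemidef → (cfc f A - cfc f B).PosSemidef

/-! Testing the anti-Löwner form on the partial fraction coefficients of `p / ∏ (X + x k)` collapses
the double sum to a single one, in which `g (x i) / x i` is weighted by `p (x i) * p (-x i)` over
differences of squares. In the variables `t = x ^ 2`, the choices `p = X * r(X ^ 2)` and `p = r(X ^
2)` say that `√t * g √t` and `-(g √t / √t)`, each multiplied by `r ^ 2`, have nonnegative divided
differences at any `2 * N` points when `deg r < N`.

This property yields monotonicity of order `N` as in Löwner's theorem. For `B = A + c * cᴴ` in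
general position, the eigenvalues of `A` and `B` are `2 * N` distinct nodes, and the unitary between
the eigenbases is a Cauchy-type matrix. Interpolation turns `⟨w, (F(B) - F(A)) w⟩` into two such
divided differences, for real and imaginary parts (`cauchy_sum_le`, `sum_normSq_le`). A perturbation
argument, using continuity of `F`, removes general position; a positive semidefinite `B - A` is then
split into rank one terms.

Continuity comes from the scalar case: `√t * g √t` increases, while its quotient by `t` decreases.
-/

open Polynomial in
/-- The divided differences of `F * r ^ 2` at `2 * n` distinct points of `J` are nonnegative for
all real polynomials `r` of degree less than `n`. -/
def HasNonnegDividedDifferences (n : ℕ) (F : ℝ → ℝ) (J : Set ℝ) : Prop :=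
  ∀ t : Fin n ⊕ Fin n → ℝ, (∀ i, t i ∈ J) → Function.Injective t → ∀ r : ℝ[X], r.degree < n →
    0 ≤ ∑ i, F (t i) * r.eval (t i) ^ 2 * Lagrange.nodalWeight Finset.univ t i

/-! ### Divided differences and Cauchy systems over the reals. -/

section Scalar

open Polynomial Finset

lemma IsAntiLoewnerOn.sum_nonneg {n : ℕ} {g : ℝ → ℝ} {I : Set ℝ} (hg : IsAntiLoewnerOn n g I)
    {ι : Type*} [Fintype ι] (hι : Fintype.card ι = n) (x : ι → ℝ) (hx : ∀ i, x i ∈ I)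
    (hinj : Function.Injective x) (c : ι → ℝ) :
    0 ≤ ∑ i, ∑ j, c i * c j * ((g (x i) + g (x j)) / (x i + x j)) := by
  let e : Fin n ≃ ι := (Fintype.equivFinOfCardEq hι).symm
  have h := (hg (x ∘ e) (fun i => hx _) (hinj.comp e.injective)).dotProduct_mulVec_nonneg (c ∘ e)
  simp only [dotProduct, Matrix.mulVec, antiLoewnerMatrix, Matrix.of_apply, mul_sum] at h
  rw [← e.sum_comp]
  refine h.trans_eq (sum_congr rfl fun i _ => ?_)
  rw [← e.sum_comp]
  refine sum_congr rfl fun j _ => ?_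
  simp only [Function.comp_apply, Pi.star_apply, star_trivial]
  ring

/-- The test vector `c` consists of the residues of `p / ∏ (X + x k)` at the nodes `-x j`.
Evaluating the partial fraction expansion at `x i` sums the Cauchy kernel `1 / (x i + x j)` in
closed form. -/
lemma IsAntiLoewnerOn.sum_eval_nonneg {n : ℕ} {g : ℝ → ℝ} {I : Set ℝ} (hg : IsAntiLoewnerOn n g I)
    (hI : ∀ x ∈ I, 0 < x) {ι : Type*} [Fintype ι] [DecidableEq ι] (hι : Fintype.card ι = n)
    (x : ι → ℝ) (hx : ∀ i, x i ∈ I) (hinj : Function.Injective x) (p : ℝ[X]) (hp : p.degree < n) :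
    0 ≤ ∑ i, g (x i) / x i * (p.eval (x i) * p.eval (-x i)) *
      ∏ k ∈ univ.erase i, (x k ^ 2 - x i ^ 2)⁻¹ := by
  have hpos : ∀ i, 0 < x i := fun i => hI _ (hx i)
  set y : ι → ℝ := fun i => -x i with hy
  have hyinj : Set.InjOn y (univ : Finset ι) := fun i _ j _ h => hinj (neg_injective h)
  set c : ι → ℝ := fun j => Lagrange.nodalWeight univ y j * p.eval (y j) with hc
  have key : ∀ i, ∑ j, c j * (x i + x j)⁻¹ = p.eval (x i) * ∏ k, (x i + x k)⁻¹ := by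
    intro i
    have h1 := Lagrange.eval_interpolate_not_at_node (s := univ) (v := y)
      (fun j => p.eval (y j)) (x := x i) (fun j _ => by
        have := hpos i; have := hpos j; simp only [hy]; linarith)
    rw [← Lagrange.eq_interpolate hyinj (by rwa [card_univ, hι]), Lagrange.eval_nodal] at h1
    rw [h1, prod_inv_distrib]
    have : ∏ k, (x i - y k) = ∏ k, (x i + x k) := by simp [hy]
    rw [this, mul_comm (_ * _), ← mul_assoc, inv_mul_cancel₀, one_mul]
    · exact sum_congr rfl fun j _ => by simp only [hc, hy]; ring
    · exact prod_ne_zero_iff.2 fun k _ => (add_pos (hpos i) (hpos k)).ne'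
  have h2 := hg.sum_nonneg hι x hx hinj c
  -- By symmetry in `i` and `j`, both terms of `g (x i) + g (x j)` contribute equally. The factor 2
  -- later cancels against the `k = i` factor `1 / (2 * x i)`.
  have h3 : ∑ i, ∑ j, c i * c j * ((g (x i) + g (x j)) / (x i + x j)) =
      2 * ∑ i, c i * g (x i) * ∑ j, c j * (x i + x j)⁻¹ := by
    have e1 : ∑ i, ∑ j, c i * c j * ((g (x i) + g (x j)) / (x i + x j)) =
      ∑ i, ∑ j, c i * g (x i) * (c j * (x i + x j)⁻¹) +
        ∑ i, ∑ j, c j * g (x j) * (c i * (x j + x i)⁻¹) := by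
      simp only [← sum_add_distrib]
      refine sum_congr rfl fun i _ => sum_congr rfl fun j _ => ?_
      rw [add_comm (x j), div_eq_mul_inv]
      ring
    rw [e1, sum_comm (f := fun i j => c j * g (x j) * (c i * (x j + x i)⁻¹)), ← two_mul]
    simp only [mul_sum]
  rw [h3] at h2
  rw [mul_sum] at h2
  refine h2.trans_eq (sum_congr rfl fun i _ => ?_)
  rw [key, ← mul_prod_erase univ _ (mem_univ i)]
  have h4 : ∏ k ∈ univ.erase i, (x k ^ 2 - x i ^ 2)⁻¹ =
      Lagrange.nodalWeight univ y i * ∏ k ∈ univ.erase i, (x i + x k)⁻¹ := by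
    rw [Lagrange.nodalWeight, ← prod_mul_distrib]
    refine prod_congr rfl fun k _ => ?_
    rw [← mul_inv]; congr 1; simp only [hy]; ring
  rw [h4]
  have := (hpos i).ne'
  simp only [hc, hy]
  field_simp
  ring

lemma nodalWeight_eq_neg_prod {n : ℕ} (t : Fin n ⊕ Fin n → ℝ) (i : Fin n ⊕ Fin n) :
    Lagrange.nodalWeight univ t i = -∏ k ∈ univ.erase i, (t k - t i)⁻¹ := by
  have hn : 0 < n := by rcases i with i | i <;> exact i.pos
  have hodd : Odd (univ.erase i).card := by
    rw [card_erase_of_mem (mem_univ i)]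
    simp only [card_univ, Fintype.card_sum, Fintype.card_fin]
    exact ⟨n - 1, by omega⟩
  rw [Lagrange.nodalWeight, ← neg_one_mul, ← hodd.neg_one_pow (α := ℝ), ← prod_const,
    ← prod_mul_distrib]
  exact prod_congr rfl fun k _ => by rw [← neg_sub, inv_neg, neg_one_mul]

variable {N : ℕ} {g : ℝ → ℝ} {I J : Set ℝ}

lemma degree_comp_X_sq_lt {r : ℝ[X]} (hr : r.degree < (N : WithBot ℕ)) :
    (X * r.comp (X ^ 2)).degree < ((2 * N : ℕ) : WithBot ℕ) ∧
      (r.comp (X ^ 2)).degree < ((2 * N : ℕ) : WithBot ℕ) := by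
  rcases eq_or_ne r 0 with rfl | h0
  · simp only [zero_comp, mul_zero, degree_zero]
    exact ⟨WithBot.bot_lt_coe _, WithBot.bot_lt_coe _⟩
  rw [degree_eq_natDegree h0, Nat.cast_lt] at hr
  have h1 : (r.comp (X ^ 2)).natDegree = r.natDegree * 2 := by simp [natDegree_comp]
  have h2 : (X * r.comp (X ^ 2)).natDegree ≤ 1 + r.natDegree * 2 := by
    rw [← h1]
    exact natDegree_mul_le.trans (by simp)
  constructor
  · exact degree_le_natDegree.trans_lt (Nat.cast_lt.2 (by omega))
  · exact degree_le_natDegree.trans_lt (Nat.cast_lt.2 (by omega))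

/-- With `p = X * r(X ^ 2)` one has `p(x) * p(-x) = -x ^ 2 * r(x ^ 2) ^ 2`; the minus sign cancels
the one in `nodalWeight_eq_neg_prod`. -/
lemma IsAntiLoewnerOn.hasNonnegDividedDifferences_mul_sqrt (hg : IsAntiLoewnerOn (2 * N) g I)
    (hI : ∀ x ∈ I, 0 < x) (hJ : ∀ x ∈ J, 0 < x ∧ √x ∈ I) :
    HasNonnegDividedDifferences N (fun x => √x * g √x) J := by
  intro t ht hinj r hr
  have h := hg.sum_eval_nonneg hI (by simp [two_mul]) (fun i => √(t i)) (fun i => (hJ _ (ht i)).2)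
    (fun i j hij => hinj ((Real.sqrt_inj (hJ _ (ht i)).1.le (hJ _ (ht j)).1.le).1 hij))
    (X * r.comp (X ^ 2)) (degree_comp_X_sq_lt hr).1
  refine h.trans_eq (sum_congr rfl fun i _ => ?_)
  have hs : ∀ k, √(t k) ^ 2 = t k := fun k => Real.sq_sqrt (hJ _ (ht k)).1.le
  have hp := (Real.sqrt_pos.2 (hJ _ (ht i)).1).ne'
  simp only [nodalWeight_eq_neg_prod, hs, eval_mul, eval_X, eval_comp, eval_pow, neg_sq]
  field_simp

/-- Here `p = r(X ^ 2)` is even, so `p(x) * p(-x)` is a square and the sign of the nodal weight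
survives. -/
lemma IsAntiLoewnerOn.hasNonnegDividedDifferences_neg_div_sqrt (hg : IsAntiLoewnerOn (2 * N) g I)
    (hI : ∀ x ∈ I, 0 < x) (hJ : ∀ x ∈ J, 0 < x ∧ √x ∈ I) :
    HasNonnegDividedDifferences N (fun x => -(g √x / √x)) J := by
  intro t ht hinj r hr
  have h := hg.sum_eval_nonneg hI (by simp [two_mul]) (fun i => √(t i)) (fun i => (hJ _ (ht i)).2)
    (fun i j hij => hinj ((Real.sqrt_inj (hJ _ (ht i)).1.le (hJ _ (ht j)).1.le).1 hij))
    (r.comp (X ^ 2)) (degree_comp_X_sq_lt hr).2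
  refine h.trans_eq (sum_congr rfl fun i _ => ?_)
  have hs : ∀ k, √(t k) ^ 2 = t k := fun k => Real.sq_sqrt (hJ _ (ht k)).1.le
  simp only [nodalWeight_eq_neg_prod, hs, eval_X, eval_comp, eval_pow, neg_sq]
  ring

/-- A Cauchy system `∑ i, A i / (μ j - l i) = 1` determines the residues `A i`. -/
lemma cauchy_residue {l μ A : Fin N → ℝ} (hl : Function.Injective l) (hμ : Function.Injective μ)
    (hne : ∀ i j, μ j ≠ l i) (hA : ∀ j, ∑ i, A i / (μ j - l i) = 1) (i : Fin N) :
    A i * ∏ k ∈ univ.erase i, (l i - l k) = -∏ j, (l i - μ j) := by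
  set P : Fin N → ℝ := fun i => ∏ k ∈ univ.erase i, (l i - l k) with hP
  have hP0 : ∀ i, P i ≠ 0 := fun i => prod_ne_zero_iff.2 fun k hk =>
    sub_ne_zero.2 fun h => ne_of_mem_erase hk (hl h).symm
  -- This `p` is the numerator of `∑ i, A i / (X - l i)` over the nodal polynomial of `l`. The
  -- system makes it agree with that polynomial at every `μ j`, so it must be the difference of the
  -- two monic nodal polynomials.
  set p := Lagrange.interpolate univ l (fun i => A i * P i) with hp
  have hpd : p.degree < (N : ℕ) := by
    exact (Lagrange.degree_interpolate_lt (s := univ) (v := l) _ hl.injOn).trans_eq (by simp)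
  have hpe : ∀ j, p.eval (μ j) = (Lagrange.nodal univ l).eval (μ j) := by
    intro j
    rw [hp, Lagrange.eval_interpolate_not_at_node _ fun i _ => hne i j]
    convert mul_one _
    rw [← hA j]
    refine sum_congr rfl fun i _ => ?_
    rw [Lagrange.nodalWeight, prod_inv_distrib]
    have := hP0 i
    simp only [hP] at this ⊢
    field_simp
  have hd : (Lagrange.nodal univ l - Lagrange.nodal univ μ : ℝ[X]).degree < (N : ℕ) := by
    refine (degree_sub_lt_left ?_ Lagrange.nodal_ne_zero ?_).trans_eq ?_
    · rw [Lagrange.degree_nodal, Lagrange.degree_nodal]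
    · rw [Lagrange.nodal_monic.leadingCoeff, Lagrange.nodal_monic.leadingCoeff]
    · simp [Lagrange.degree_nodal]
  have heq := eq_of_degrees_lt_of_eval_index_eq (f := p) univ hμ.injOn
    (hpd.trans_eq (by simp)) (hd.trans_eq (by simp)) (fun j _ => by
      rw [hpe, eval_sub, Lagrange.eval_nodal_at_node (v := μ) (mem_univ j), sub_zero])
  have h := congrArg (eval (l i)) heq
  rw [hp, Lagrange.eval_interpolate_at_node _ hl.injOn (mem_univ i), eval_sub,
    Lagrange.eval_nodal_at_node (v := l) (mem_univ i), zero_sub, Lagrange.eval_nodal] at h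
  exact h

lemma nodalWeight_sumElim_inl (l μ : Fin N → ℝ) (i : Fin N) :
    Lagrange.nodalWeight univ (Sum.elim l μ) (Sum.inl i) =
      (∏ k ∈ univ.erase i, (l i - l k))⁻¹ * (∏ j, (l i - μ j))⁻¹ := by
  have : (univ.erase (Sum.inl i) : Finset (Fin N ⊕ Fin N)) = (univ.erase i).disjSum univ := by
    ext (k | k) <;> simp
  rw [Lagrange.nodalWeight, this, prod_disjSum]
  simp [prod_inv_distrib]

lemma nodalWeight_sumElim_inr (l μ : Fin N → ℝ) (j : Fin N) :
    Lagrange.nodalWeight univ (Sum.elim l μ) (Sum.inr j) =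
      (∏ i, (μ j - l i))⁻¹ * (∏ k ∈ univ.erase j, (μ j - μ k))⁻¹ := by
  have : (univ.erase (Sum.inr j) : Finset (Fin N ⊕ Fin N)) = univ.disjSum (univ.erase j) := by
    ext (k | k) <;> simp
  rw [Lagrange.nodalWeight, this, prod_disjSum]
  simp [prod_inv_distrib]

/-- Let `r` be the numerator of `∑ i, ρ i / (X - l i)`. By `cauchy_residue` the nodal weights at the
points `l` and `μ` are expressed through `A` and `B`, and the divided difference of `F * r ^ 2` is
exactly the right side minus the left. -/
lemma HasNonnegDividedDifferences.cauchy_sum_le {F : ℝ → ℝ}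
    (hF : HasNonnegDividedDifferences N F J) {l μ A B ρ σ : Fin N → ℝ}
    (hlJ : ∀ i, l i ∈ J) (hμJ : ∀ i, μ i ∈ J)
    (hl : Function.Injective l) (hμ : Function.Injective μ) (hne : ∀ i j, μ j ≠ l i)
    (hA0 : ∀ i, A i ≠ 0) (hB0 : ∀ j, B j ≠ 0)
    (hA : ∀ j, ∑ i, A i / (μ j - l i) = 1) (hB : ∀ i, ∑ j, B j / (μ j - l i) = 1)
    (hσ : ∀ j, σ j = B j * ∑ i, ρ i / (μ j - l i)) :
    ∑ i, F (l i) * (ρ i ^ 2 / A i) ≤ ∑ j, F (μ j) * (σ j ^ 2 / B j) := by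
  set P : Fin N → ℝ := fun i => ∏ k ∈ univ.erase i, (l i - l k) with hP
  set Q : Fin N → ℝ := fun i => ∏ k ∈ univ.erase i, (μ i - μ k) with hQ
  have hP0 : ∀ i, P i ≠ 0 := fun i => prod_ne_zero_iff.2 fun k hk =>
    sub_ne_zero.2 fun h => ne_of_mem_erase hk (hl h).symm
  have hQ0 : ∀ i, Q i ≠ 0 := fun i => prod_ne_zero_iff.2 fun k hk =>
    sub_ne_zero.2 fun h => ne_of_mem_erase hk (hμ h).symm
  have hAP : ∀ i, ∏ j, (l i - μ j) = -(A i * P i) := fun i => by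
    rw [hP, cauchy_residue hl hμ hne hA i, neg_neg]
  have hBQ : ∀ j, ∏ i, (μ j - l i) = B j * Q j := fun j => by
    have := cauchy_residue (A := fun j => -B j) hμ hl (fun i j => (hne j i).symm) (fun i => by
      rw [← hB i]
      refine sum_congr rfl fun j _ => ?_
      rw [← neg_sub, div_neg, neg_div, neg_neg]) j
    simp only [hQ]
    linarith
  set r := Lagrange.interpolate univ l (fun i => ρ i * P i) with hr
  have hrd : r.degree < (N : ℕ) := by
    exact (Lagrange.degree_interpolate_lt (s := univ) (v := l) _ hl.injOn).trans_eq (by simp)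
  have hrl : ∀ i, r.eval (l i) = ρ i * P i := fun i => by
    rw [hr, Lagrange.eval_interpolate_at_node _ hl.injOn (mem_univ i)]
  have hrμ : ∀ j, r.eval (μ j) = σ j * Q j := by
    intro j
    rw [hr, Lagrange.eval_interpolate_not_at_node _ fun i _ => hne i j, Lagrange.eval_nodal, hBQ,
      hσ, mul_right_comm (B j) _ (Q j)]
    congr 1
    refine sum_congr rfl fun i _ => ?_
    rw [Lagrange.nodalWeight, prod_inv_distrib]
    have := hP0 i
    simp only [hP] at this ⊢
    field_simp
  have h := hF (Sum.elim l μ) (by rintro (i | i); exacts [hlJ i, hμJ i])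
    (Function.Injective.sumElim hl hμ fun i j => (hne i j).symm) r hrd
  rw [Fintype.sum_sum_type] at h
  simp only [nodalWeight_sumElim_inl, nodalWeight_sumElim_inr, Sum.elim_inl, Sum.elim_inr, hrl, hrμ,
    hAP, hBQ] at h
  have e1 : ∑ i, F (l i) * (ρ i * P i) ^ 2 *
      ((∏ k ∈ univ.erase i, (l i - l k))⁻¹ * (-(A i * P i))⁻¹) =
      -∑ i, F (l i) * (ρ i ^ 2 / A i) := by
    rw [← sum_neg_distrib]
    refine sum_congr rfl fun i _ => ?_
    have := hP0 i
    have := hA0 i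
    change _ * ((P i)⁻¹ * _) = _
    rw [inv_neg]
    field_simp
  have e2 : ∑ j, F (μ j) * (σ j * Q j) ^ 2 *
      ((B j * Q j)⁻¹ * (∏ k ∈ univ.erase j, (μ j - μ k))⁻¹) =
      ∑ j, F (μ j) * (σ j ^ 2 / B j) := by
    refine sum_congr rfl fun i _ => ?_
    have := hQ0 i
    have := hB0 i
    change _ * (_ * (Q i)⁻¹) = _
    field_simp
  rw [e1, e2] at h
  linarith

end Scalar

/-! ### Rank one perturbations in general position. -/

section RankOne

open Matrix

variable {N : ℕ} {F : ℝ → ℝ} {J : Set ℝ}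

/-- Here `l`, `μ` play the eigenvalues of `A` and `B = A + c * cᴴ`, `a`, `b` the coordinates of `c`
in the two eigenbases, and `α`, `β` those of a test vector. The relation `hrel` determines `W`, and
unitarity supplies the Cauchy systems. -/
lemma HasNonnegDividedDifferences.sum_normSq_le (hF : HasNonnegDividedDifferences N F J)
    {l μ : Fin N → ℝ} (hlJ : ∀ i, l i ∈ J) (hμJ : ∀ i, μ i ∈ J)
    {W : Matrix (Fin N) (Fin N) ℂ} (hW : Wᴴ * W = 1) {a b α β : Fin N → ℂ}
    (hrel : ∀ i j, ((μ j - l i : ℝ) : ℂ) * W i j = a i * star (b j))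
    (ha : a = W *ᵥ b) (ha0 : ∀ i, a i ≠ 0) (hb0 : ∀ j, b j ≠ 0) (hα : α = W *ᵥ β) :
    ∑ i, F (l i) * Complex.normSq (α i) ≤ ∑ j, F (μ j) * Complex.normSq (β j) := by
  have hW' : W * Wᴴ = 1 := mul_eq_one_comm.1 hW
  have hb : b = Wᴴ *ᵥ a := by rw [ha, mulVec_mulVec, hW, one_mulVec]
  have hβ : β = Wᴴ *ᵥ α := by rw [hα, mulVec_mulVec, hW, one_mulVec]
  have hne : ∀ i j, μ j ≠ l i := fun i j h => by
    have := hrel i j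
    rw [h, sub_self, Complex.ofReal_zero, zero_mul] at this
    exact mul_ne_zero (ha0 i) (star_ne_zero.2 (hb0 j)) this.symm
  have hneC : ∀ i j, ((μ j - l i : ℝ) : ℂ) ≠ 0 := fun i j =>
    Complex.ofReal_ne_zero.2 (sub_ne_zero.2 (hne i j))
  have hWe : ∀ i j, W i j = a i * star (b j) / ((μ j - l i : ℝ) : ℂ) := fun i j => by
    rw [← hrel, mul_div_cancel_left₀ _ (hneC i j)]
  have hW0 : ∀ i j, W i j ≠ 0 := fun i j => by
    rw [hWe]
    exact div_ne_zero (mul_ne_zero (ha0 i) (star_ne_zero.2 (hb0 j))) (hneC i j)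
  -- Equal `μ j` and `μ k` would make two columns of `W` proportional with nonzero entries, although
  -- they are orthogonal.
  have hμ : Function.Injective μ := by
    intro j k hjk
    by_contra hne'
    have h1 := congrFun (congrFun hW j) k
    rw [one_apply_ne hne', mul_apply] at h1
    have h2 : ∑ i, ((Complex.normSq (W i j) : ℝ) : ℂ) = 0 := by
      have h3 : ∀ i, Wᴴ j i * W i k = ((Complex.normSq (W i j) : ℝ) : ℂ) * (star (b k) / star (b j)) := by
        intro i
        have hbj := star_ne_zero.2 (hb0 j)
        have : W i k = W i j * (star (b k) / star (b j)) := by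
          rw [hWe, hWe, hjk]
          field_simp
        rw [this, conjTranspose_apply, ← mul_assoc, Complex.normSq_eq_conj_mul_self]
        rfl
      rw [Finset.sum_congr rfl fun i _ => h3 i, ← Finset.sum_mul] at h1
      exact (mul_eq_zero.1 h1).resolve_right
        (div_ne_zero (star_ne_zero.2 (hb0 k)) (star_ne_zero.2 (hb0 j)))
    rw [← Complex.ofReal_sum, Complex.ofReal_eq_zero,
      Finset.sum_eq_zero_iff_of_nonneg fun i _ => Complex.normSq_nonneg _] at h2
    exact hW0 j j (Complex.normSq_eq_zero.1 (h2 j (Finset.mem_univ _)))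
  have hl : Function.Injective l := by
    intro j k hjk
    by_contra hne'
    have h1 := congrFun (congrFun hW' j) k
    rw [one_apply_ne hne', mul_apply] at h1
    have h2 : ∑ i, ((Complex.normSq (W j i) : ℝ) : ℂ) = 0 := by
      have h3 : ∀ i, W j i * Wᴴ i k = ((Complex.normSq (W j i) : ℝ) : ℂ) * star (a k / a j) := by
        intro i
        have haj := ha0 j
        have : W k i = W j i * (a k / a j) := by
          rw [hWe, hWe, hjk]
          field_simp
        rw [conjTranspose_apply, this, star_mul', ← mul_assoc, ← Complex.mul_conj]
        rfl
      rw [Finset.sum_congr rfl fun i _ => h3 i, ← Finset.sum_mul] at h1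
      exact (mul_eq_zero.1 h1).resolve_right
        (star_ne_zero.2 (div_ne_zero (ha0 k) (ha0 j)))
    rw [← Complex.ofReal_sum, Complex.ofReal_eq_zero,
      Finset.sum_eq_zero_iff_of_nonneg fun i _ => Complex.normSq_nonneg _] at h2
    exact hW0 j j (Complex.normSq_eq_zero.1 (h2 j (Finset.mem_univ _)))
  have hA : ∀ j, ∑ i, Complex.normSq (a i) / (μ j - l i) = 1 := by
    intro j
    have h1 := congrFun hb j
    have h2 : b j = b j * ((∑ i, Complex.normSq (a i) / (μ j - l i) : ℝ) : ℂ) := by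
      conv_lhs => rw [h1]
      simp only [mulVec, dotProduct, Complex.ofReal_sum, Finset.mul_sum]
      refine Finset.sum_congr rfl fun i _ => ?_
      rw [conjTranspose_apply, hWe, Complex.ofReal_div, Complex.normSq_eq_conj_mul_self]
      simp only [star_div₀, star_mul', RCLike.star_def, Complex.conj_ofReal, Complex.conj_conj]
      ring
    exact_mod_cast mul_left_cancel₀ (hb0 j) (h2.symm.trans (mul_one _).symm)
  have hB : ∀ i, ∑ j, Complex.normSq (b j) / (μ j - l i) = 1 := by
    intro i
    have h1 := congrFun ha i
    have h2 : a i = a i * ((∑ j, Complex.normSq (b j) / (μ j - l i) : ℝ) : ℂ) := by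
      conv_lhs => rw [h1]
      simp only [mulVec, dotProduct, Complex.ofReal_sum, Finset.mul_sum]
      refine Finset.sum_congr rfl fun j _ => ?_
      rw [hWe, Complex.ofReal_div, Complex.normSq_eq_conj_mul_self]
      simp only [RCLike.star_def]
      ring
    exact_mod_cast mul_left_cancel₀ (ha0 i) (h2.symm.trans (mul_one _).symm)
  have hy : ∀ j, star (b j) * β j = ∑ i, ((Complex.normSq (b j) / (μ j - l i) : ℝ) : ℂ) *
      (star (a i) * α i) := by
    intro j
    rw [congrFun hβ j]
    simp only [mulVec, dotProduct, Finset.mul_sum]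
    refine Finset.sum_congr rfl fun i _ => ?_
    rw [conjTranspose_apply, hWe, Complex.ofReal_div, Complex.normSq_eq_conj_mul_self]
    simp only [star_div₀, star_mul', RCLike.star_def, Complex.conj_ofReal, Complex.conj_conj]
    ring
  have hA0 : ∀ i, Complex.normSq (a i) ≠ 0 := fun i => by simpa using ha0 i
  have hB0 : ∀ i, Complex.normSq (b i) ≠ 0 := fun i => by simpa using hb0 i
  -- The Cauchy coefficients are real, so real and imaginary parts transform separately.
  have hre := hF.cauchy_sum_le (ρ := fun i => (star (a i) * α i).re)
    (σ := fun j => (star (b j) * β j).re) hlJ hμJ hl hμ hne hA0 hB0 hA hB fun j => by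
      rw [hy, Complex.re_sum, Finset.mul_sum]
      refine Finset.sum_congr rfl fun i _ => ?_
      rw [Complex.re_ofReal_mul]
      ring
  have him := hF.cauchy_sum_le (ρ := fun i => (star (a i) * α i).im)
    (σ := fun j => (star (b j) * β j).im) hlJ hμJ hl hμ hne hA0 hB0 hA hB fun j => by
      rw [hy, Complex.im_sum, Finset.mul_sum]
      refine Finset.sum_congr rfl fun i _ => ?_
      rw [Complex.im_ofReal_mul]
      ring
  have hsplit : ∀ {u v : ℂ}, u ≠ 0 → Complex.normSq v =
      (star u * v).re ^ 2 / Complex.normSq u + (star u * v).im ^ 2 / Complex.normSq u := by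
    intro u v hu
    have hu' : Complex.normSq u ≠ 0 := by simpa using hu
    rw [← add_div, sq, sq, ← Complex.normSq_apply, map_mul, RCLike.star_def, Complex.normSq_conj,
      mul_div_cancel_left₀ _ hu']
  simp only [fun i => hsplit (v := α i) (ha0 i), fun i => hsplit (v := β i) (hb0 i), mul_add,
    Finset.sum_add_distrib]
  exact add_le_add hre him

lemma Matrix.IsHermitian.eq_conj_diagonal {A : Matrix (Fin N) (Fin N) ℂ} (hA : A.IsHermitian) :
    A = (hA.eigenvectorUnitary : Matrix (Fin N) (Fin N) ℂ) *
      diagonal (fun i => (hA.eigenvalues i : ℂ)) *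
        (hA.eigenvectorUnitary : Matrix (Fin N) (Fin N) ℂ)ᴴ := by
  conv_lhs => rw [hA.spectral_theorem]
  rw [Unitary.conjStarAlgAut_apply]
  rfl

lemma Matrix.IsHermitian.dotProduct_cfc_mulVec {A : Matrix (Fin N) (Fin N) ℂ} (hA : A.IsHermitian)
    (f : ℝ → ℝ) (w : Fin N → ℂ) :
    star w ⬝ᵥ (cfc f A *ᵥ w) = ((∑ i, f (hA.eigenvalues i) *
      Complex.normSq (((hA.eigenvectorUnitary : Matrix (Fin N) (Fin N) ℂ)ᴴ *ᵥ w) i) : ℝ) : ℂ) := by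
  set U := (hA.eigenvectorUnitary : Matrix (Fin N) (Fin N) ℂ) with hU
  have h1 : cfc f A = U * diagonal (fun i => (f (hA.eigenvalues i) : ℂ)) * Uᴴ := by
    rw [hA.cfc_eq, IsHermitian.cfc, Unitary.conjStarAlgAut_apply]
    rfl
  rw [h1, ← mulVec_mulVec, ← mulVec_mulVec, dotProduct_mulVec,
    show star w ᵥ* U = star (Uᴴ *ᵥ w) by rw [star_mulVec, conjTranspose_conjTranspose]]
  simp only [dotProduct, mulVec_diagonal, Pi.star_apply, Complex.ofReal_sum, Complex.ofReal_mul,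
    Complex.normSq_eq_conj_mul_self]
  exact Finset.sum_congr rfl fun i _ => by simp only [RCLike.star_def]; ring

lemma Matrix.IsHermitian.conjTranspose_eigenvectorUnitary_mul {A : Matrix (Fin N) (Fin N) ℂ}
    (hA : A.IsHermitian) : (hA.eigenvectorUnitary : Matrix (Fin N) (Fin N) ℂ)ᴴ *
      (hA.eigenvectorUnitary : Matrix (Fin N) (Fin N) ℂ) = 1 :=
  Unitary.coe_star_mul_self hA.eigenvectorUnitary

/-- Monotonicity under a rank one perturbation `c * cᴴ` for which no eigenvector of `A` is
orthogonal to `c`. -/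
lemma HasNonnegDividedDifferences.dotProduct_cfc_le_of_cyclic
    (hF : HasNonnegDividedDifferences N F J) {A B : Matrix (Fin N) (Fin N) ℂ} (hA : A.IsHermitian)
    (hB : B.IsHermitian) (hAJ : spectrum ℝ A ⊆ J) (hBJ : spectrum ℝ B ⊆ J) {c : Fin N → ℂ}
    (hAB : B = A + vecMulVec c (star c))
    (hc : ∀ (v : Fin N → ℂ) (z : ℂ), A *ᵥ v = z • v → star c ⬝ᵥ v = 0 → v = 0) (w : Fin N → ℂ) :
    star w ⬝ᵥ (cfc F A *ᵥ w) ≤ star w ⬝ᵥ (cfc F B *ᵥ w) := by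
  rw [hA.dotProduct_cfc_mulVec, hB.dotProduct_cfc_mulVec, Complex.real_le_real]
  set U := (hA.eigenvectorUnitary : Matrix (Fin N) (Fin N) ℂ) with hU
  set V := (hB.eigenvectorUnitary : Matrix (Fin N) (Fin N) ℂ) with hV
  have hUU : Uᴴ * U = 1 := hA.conjTranspose_eigenvectorUnitary_mul
  have hVV : Vᴴ * V = 1 := hB.conjTranspose_eigenvectorUnitary_mul
  have hUU' : U * Uᴴ = 1 := mul_eq_one_comm.1 hUU
  have hVV' : V * Vᴴ = 1 := mul_eq_one_comm.1 hVV
  have hUA : Uᴴ * A = diagonal (fun i => (hA.eigenvalues i : ℂ)) * Uᴴ := by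
    conv_lhs => rw [hA.eq_conj_diagonal]
    rw [← mul_assoc, ← mul_assoc, hUU, one_mul]
  have hBV : B * V = V * diagonal (fun i => (hB.eigenvalues i : ℂ)) := by
    conv_lhs => rw [hB.eq_conj_diagonal]
    rw [mul_assoc, hVV, mul_one]
  have hstar : ∀ (T : Matrix (Fin N) (Fin N) ℂ) j, (Tᴴ *ᵥ c) j = star (star c ⬝ᵥ T.col j) := by
    intro T j
    rw [← star_dotProduct_star, star_star]
    simp [mulVec, dotProduct, mul_comm]
  have hcol0 : ∀ (T : Matrix (Fin N) (Fin N) ℂ) j, Tᴴ * T = 1 → T.col j ≠ 0 := by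
    intro T j hT h0
    have := congrFun (congrFun hT j) j
    rw [mul_apply, one_apply_eq] at this
    rw [Finset.sum_eq_zero fun i _ => by rw [show T i j = 0 from congrFun h0 i, mul_zero]] at this
    exact zero_ne_one this
  refine hF.sum_normSq_le (fun i => hAJ (hA.eigenvalues_mem_spectrum_real i))
    (fun i => hBJ (hB.eigenvalues_mem_spectrum_real i)) (W := Uᴴ * V) (a := Uᴴ *ᵥ c)
    (b := Vᴴ *ᵥ c) ?_ ?_ ?_ ?_ ?_ ?_
  · rw [conjTranspose_mul, conjTranspose_conjTranspose, mul_assoc, ← mul_assoc U, hUU', one_mul, hVV]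
  · intro i j
    have h1 : Uᴴ * V * diagonal (fun i => (hB.eigenvalues i : ℂ)) -
        diagonal (fun i => (hA.eigenvalues i : ℂ)) * (Uᴴ * V) =
        vecMulVec (Uᴴ *ᵥ c) (star (Vᴴ *ᵥ c)) := by
      rw [mul_assoc, ← hBV, ← mul_assoc (diagonal _), ← hUA, mul_assoc, ← mul_sub, ← sub_mul,
        show B - A = vecMulVec c (star c) by rw [hAB, add_sub_cancel_left], vecMulVec_mul, mul_vecMulVec, star_mulVec, conjTranspose_conjTranspose]
    have h2 := congrFun (congrFun h1 i) j
    rw [Matrix.sub_apply, mul_diagonal, diagonal_mul, vecMulVec_apply, Pi.star_apply] at h2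
    rw [← h2, Complex.ofReal_sub]
    ring
  · rw [mulVec_mulVec, mul_assoc, hVV', mul_one]
  · intro i hi
    rw [hstar, star_eq_zero] at hi
    refine hcol0 U i hUU (hc _ (hA.eigenvalues i) ?_ hi)
    exact hA.mulVec_eigenvectorBasis i
  · intro j hj
    rw [hstar, star_eq_zero] at hj
    -- An eigenvector of `B` orthogonal to `c` is also an eigenvector of `A`.
    refine hcol0 V j hVV (hc _ (hB.eigenvalues j) ?_ hj)
    have h1 : B *ᵥ V.col j = (hB.eigenvalues j : ℂ) • V.col j := hB.mulVec_eigenvectorBasis j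
    rw [← h1]
    conv_rhs => rw [hAB]
    rw [add_mulVec, vecMulVec_mulVec, hj, MulOpposite.op_zero, zero_smul, add_zero]
  · rw [mulVec_mulVec, mul_assoc, hVV', mul_one]

end RankOne

/-! ### From general position to arbitrary perturbations. -/

section Approximation

open Matrix Filter Topology

variable {N : ℕ} {F : ℝ → ℝ} {J : Set ℝ}

lemma Matrix.eq_zero_of_cyclic {U : Matrix (Fin N) (Fin N) ℂ} (hU : Uᴴ * U = 1) {d γ : Fin N → ℂ}
    (hd : Function.Injective d) (hγ : ∀ i, γ i ≠ 0) {v : Fin N → ℂ} {z : ℂ}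
    (hv : (U * diagonal d * Uᴴ) *ᵥ v = z • v) (hc : star (U *ᵥ γ) ⬝ᵥ v = 0) : v = 0 := by
  have hU' : U * Uᴴ = 1 := mul_eq_one_comm.1 hU
  have h1 : ∀ i, d i * (Uᴴ *ᵥ v) i = z * (Uᴴ *ᵥ v) i := by
    intro i
    have := congrFun (congrArg (Uᴴ *ᵥ ·) hv) i
    simp only [mulVec_mulVec, ← mul_assoc, hU, one_mul, mulVec_smul] at this
    rwa [← mulVec_mulVec, mulVec_diagonal] at this
  rw [star_mulVec, ← dotProduct_mulVec] at hc
  suffices h : Uᴴ *ᵥ v = 0 by rw [← one_mulVec v, ← hU', ← mulVec_mulVec, h, mulVec_zero]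
  by_contra h
  obtain ⟨i, hi⟩ := Function.ne_iff.1 h
  have hz : d i = z := mul_right_cancel₀ hi (h1 i)
  rw [dotProduct, Finset.sum_eq_single i] at hc
  · exact mul_ne_zero (star_ne_zero.2 (hγ i)) hi hc
  · intro k _ hk
    have : (Uᴴ *ᵥ v) k = 0 := by
      by_contra h0
      exact hk (hd ((mul_right_cancel₀ h0 (h1 k)).trans hz.symm))
    rw [this, mul_zero]
  · simp

-- Upper hemicontinuity traps nearby spectra in one compact subset of `J`, on which `F` is
-- continuous.
open scoped Matrix.Norms.L2Operator in
lemma Matrix.tendsto_cfc_of_isOpen (hJ : IsOpen J) (hFc : ContinuousOn F J)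
    {A : ℝ → Matrix (Fin N) (Fin N) ℂ} {x : ℝ} (hA : ContinuousAt A x) (hAh : ∀ e, (A e).IsHermitian)
    (hs : spectrum ℝ (A x) ⊆ J) :
    (∀ᶠ e in 𝓝 x, spectrum ℝ (A e) ⊆ J) ∧
      Tendsto (fun e => cfc F (A e)) (𝓝 x) (𝓝 (cfc F (A x))) := by
  obtain ⟨S, ⟨hS₁, hS₂⟩, hS₃⟩ := (spectrum.isCompact (𝕜 := ℝ) (A x)).nhdsSet_basis_isCompact.mem_iff.mp
    (hJ.mem_nhdsSet.2 hs)
  have h1 : ∀ᶠ e in 𝓝 x, spectrum ℝ (A e) ⊆ S := hA.eventually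
    ((upperHemicontinuous_spectrum ℝ _ |>.upperHemicontinuousAt (A x) _ hS₁).mono
      fun _ => subset_of_mem_nhdsSet)
  exact ⟨h1.mono fun e he => he.trans hS₃, hA.tendsto.cfc hS₂ F h1 (Eventually.of_forall hAh)
    h1.self_of_nhds (hAh x) (hFc.mono hS₃)⟩

lemma HasNonnegDividedDifferences.dotProduct_cfc_le_of_rankOne
    (hF : HasNonnegDividedDifferences N F J) (hJ : IsOpen J) (hFc : ContinuousOn F J)
    {A B : Matrix (Fin N) (Fin N) ℂ} (hA : A.IsHermitian)
    (hAJ : spectrum ℝ A ⊆ J) (hBJ : spectrum ℝ B ⊆ J) {c : Fin N → ℂ}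
    (hAB : B = A + vecMulVec c (star c)) (w : Fin N → ℂ) :
    star w ⬝ᵥ (cfc F A *ᵥ w) ≤ star w ⬝ᵥ (cfc F B *ᵥ w) := by
  set U := (hA.eigenvectorUnitary : Matrix (Fin N) (Fin N) ℂ) with hU
  have hUU : Uᴴ * U = 1 := hA.conjTranspose_eigenvectorUnitary_mul
  have hUU' : U * Uᴴ = 1 := mul_eq_one_comm.1 hUU
  -- Shifting the `i`th eigenvalue by `e * i` separates coinciding eigenvalues, and shifting the
  -- coordinates of `c` by `e` makes them nonzero, for all small `e ≠ 0`.
  set d : ℝ → Fin N → ℂ := fun e i => ((hA.eigenvalues i + e * (i : ℕ) : ℝ) : ℂ) with hd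
  set γ : ℝ → Fin N → ℂ := fun e i => (Uᴴ *ᵥ c) i + (e : ℂ) with hγ
  set A' : ℝ → Matrix (Fin N) (Fin N) ℂ := fun e => U * diagonal (d e) * Uᴴ with hA'
  set B' : ℝ → Matrix (Fin N) (Fin N) ℂ :=
    fun e => A' e + vecMulVec (U *ᵥ γ e) (star (U *ᵥ γ e)) with hB'
  have hA'0 : A' 0 = A := by
    conv_rhs => rw [hA.eq_conj_diagonal]
    simp [hA', hd, hU]
  have hB'0 : B' 0 = B := by
    have : U *ᵥ γ 0 = c := by simp [hγ, mulVec_mulVec, hUU']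
    rw [hB', hAB, ← hA'0, ← this]
  have hA'h : ∀ e, (A' e).IsHermitian := fun e => by
    refine isHermitian_mul_mul_conjTranspose _ ?_
    exact isHermitian_diagonal_of_self_adjoint _ (funext fun i => Complex.conj_ofReal _)
  have hB'h : ∀ e, (B' e).IsHermitian := fun e =>
    (hA'h e).add (posSemidef_vecMulVec_self_star _).isHermitian
  have hdc : Continuous d := by
    refine continuous_pi fun i => ?_
    simp only [hd]
    fun_prop
  have hγc : Continuous γ := by
    refine continuous_pi fun i => ?_
    simp only [hγ]
    fun_prop
  have hA'c : Continuous A' :=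
    (continuous_const.matrix_mul hdc.matrix_diagonal).matrix_mul continuous_const
  have hB'c : Continuous B' := by
    have h1 : Continuous fun e => U *ᵥ γ e := continuous_const.matrix_mulVec hγc
    exact hA'c.add (h1.matrix_vecMulVec h1.star)
  obtain ⟨hAs, hAt⟩ := tendsto_cfc_of_isOpen hJ hFc (x := 0) hA'c.continuousAt hA'h
    (by rwa [hA'0])
  obtain ⟨hBs, hBt⟩ := tendsto_cfc_of_isOpen hJ hFc (x := 0) hB'c.continuousAt hB'h
    (by rwa [hB'0])
  rw [hA'0] at hAt
  rw [hB'0] at hBt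
  have hlim : ∀ {T : ℝ → Matrix (Fin N) (Fin N) ℂ} {T₀}, Tendsto T (𝓝 0) (𝓝 T₀) →
      Tendsto (fun e => star w ⬝ᵥ (T e *ᵥ w)) (𝓝[≠] 0) (𝓝 (star w ⬝ᵥ (T₀ *ᵥ w))) := by
    intro T T₀ hT
    have : Continuous fun M : Matrix (Fin N) (Fin N) ℂ => star w ⬝ᵥ (M *ᵥ w) :=
      continuous_const.dotProduct (continuous_id.matrix_mulVec continuous_const)
    exact (this.tendsto _).comp (hT.mono_left nhdsWithin_le_nhds)
  have hev : ∀ k : ℝ, ∀ᶠ e in 𝓝[≠] (0 : ℝ), e ≠ k := by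
    intro k
    rcases eq_or_ne k 0 with rfl | hk
    · exact self_mem_nhdsWithin
    · exact nhdsWithin_le_nhds (isOpen_ne.mem_nhds hk.symm)
  have hdinj : ∀ᶠ e in 𝓝[≠] (0 : ℝ), Function.Injective (d e) := by
    -- The excluded value is where the `i`th and `k`th shifted eigenvalues collide; for `i = k` it
    -- is the default `0`, already absent from the punctured neighbourhood.
    have : ∀ᶠ e in 𝓝[≠] (0 : ℝ), ∀ i k : Fin N, e ≠
        (hA.eigenvalues k - hA.eigenvalues i) / ((i : ℕ) - (k : ℕ) : ℝ) :=
      eventually_all.2 fun i => eventually_all.2 fun k => hev _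
    refine this.mono fun e he i k hik => ?_
    by_contra hne
    have h1 : ((i : ℕ) - (k : ℕ) : ℝ) ≠ 0 :=
      sub_ne_zero.2 fun h => hne (Fin.ext (Nat.cast_injective h))
    refine he i k ((eq_div_iff h1).2 ?_)
    have := Complex.ofReal_injective hik
    linarith
  have hγ0 : ∀ᶠ e in 𝓝[≠] (0 : ℝ), ∀ i, γ e i ≠ 0 := by
    refine eventually_all.2 fun i => (hev (-(Uᴴ *ᵥ c) i).re).mono fun e he h => he ?_
    rw [neg_eq_of_add_eq_zero_right h, Complex.ofReal_re]
  refine le_of_tendsto_of_tendsto (hlim hAt) (hlim hBt) ?_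
  filter_upwards [hdinj, hγ0, nhdsWithin_le_nhds hAs, nhdsWithin_le_nhds hBs] with e h1 h2 h3 h4
  exact hF.dotProduct_cfc_le_of_cyclic (hA'h e) (hB'h e) h3 h4 rfl
    (fun v z hv hc => eq_zero_of_cyclic hUU h1 h2 hv hc) w

lemma Finset.exists_le_sum_mul_of_sum_eq_one {ι : Type*} [Fintype ι] (l p : ι → ℝ)
    (hp : ∀ i, 0 ≤ p i) (hsum : ∑ i, p i = 1) : ∃ i, l i ≤ ∑ k, l k * p k := by
  by_contra! h
  obtain ⟨i, -, hi⟩ : ∃ i ∈ Finset.univ, 0 < p i :=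
    Finset.exists_lt_of_sum_lt (f := fun _ => (0 : ℝ)) (by simp [hsum])
  have : ∑ k, (∑ k, l k * p k) * p k < ∑ k, l k * p k :=
    Finset.sum_lt_sum (fun k _ => mul_le_mul_of_nonneg_right (h k).le (hp k))
      ⟨i, Finset.mem_univ _, mul_lt_mul_of_pos_right (h i) hi⟩
  rw [← Finset.mul_sum, hsum, mul_one] at this
  exact this.false

/-- A Rayleigh quotient lies between two points of the spectrum. -/
lemma Matrix.IsHermitian.exists_spectrum_le_le {A : Matrix (Fin N) (Fin N) ℂ} (hA : A.IsHermitian)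
    {v : Fin N → ℂ} (hv : star v ⬝ᵥ v = 1) :
    ∃ s ∈ spectrum ℝ A, ∃ t ∈ spectrum ℝ A,
      (s : ℂ) ≤ star v ⬝ᵥ (A *ᵥ v) ∧ star v ⬝ᵥ (A *ᵥ v) ≤ (t : ℂ) := by
  have hA' : IsSelfAdjoint A := hA
  have h1 := hA.dotProduct_cfc_mulVec (fun _ => 1) v
  have h2 := hA.dotProduct_cfc_mulVec id v
  rw [cfc_const_one ℝ A, one_mulVec, hv] at h1
  rw [cfc_id ℝ A] at h2
  simp only [one_mul] at h1
  have h3 := (Complex.ofReal_injective (Complex.ofReal_one.trans h1)).symm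
  obtain ⟨i, hi⟩ := Finset.exists_le_sum_mul_of_sum_eq_one hA.eigenvalues _
    (fun i => Complex.normSq_nonneg _) h3
  -- Negating the eigenvalues gives the upper bound.
  obtain ⟨k, hk⟩ := Finset.exists_le_sum_mul_of_sum_eq_one (-hA.eigenvalues) _
    (fun i => Complex.normSq_nonneg _) h3
  refine ⟨_, hA.eigenvalues_mem_spectrum_real i, _, hA.eigenvalues_mem_spectrum_real k, ?_, ?_⟩
  · rw [h2, Complex.real_le_real]
    exact hi
  · rw [h2, Complex.real_le_real]
    simp only [Pi.neg_apply, neg_mul, Finset.sum_neg_distrib] at hk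
    exact neg_le_neg_iff.1 hk

/-- An eigenvalue of `C` is the Rayleigh quotient at a unit eigenvector, hence lies between those of
`A` and `B` at the same vector. -/
lemma Matrix.spectrum_subset_of_posSemidef_sub (hJ : J.OrdConnected)
    {A B C : Matrix (Fin N) (Fin N) ℂ} (hA : A.IsHermitian) (hB : B.IsHermitian)
    (hC : C.IsHermitian) (hAJ : spectrum ℝ A ⊆ J) (hBJ : spectrum ℝ B ⊆ J)
    (hAC : (C - A).PosSemidef) (hCB : (B - C).PosSemidef) : spectrum ℝ C ⊆ J := by
  intro s hs
  rw [hC.spectrum_real_eq_range_eigenvalues] at hs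
  obtain ⟨i, rfl⟩ := hs
  set v : Fin N → ℂ := ⇑(hC.eigenvectorBasis i) with hv
  have hv1 : star v ⬝ᵥ v = 1 := by
    have := congrFun (congrFun hC.conjTranspose_eigenvectorUnitary_mul i) i
    rwa [one_apply_eq] at this
  have hCv : star v ⬝ᵥ (C *ᵥ v) = (hC.eigenvalues i : ℂ) := by
    have h1 : C *ᵥ v = (hC.eigenvalues i : ℂ) • v := hC.mulVec_eigenvectorBasis i
    rw [h1, dotProduct_smul, hv1, smul_eq_mul, mul_one]
  obtain ⟨s, hs, -, -, hs1, -⟩ := hA.exists_spectrum_le_le hv1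
  obtain ⟨-, -, t, ht, -, ht1⟩ := hB.exists_spectrum_le_le hv1
  have h1 := hAC.dotProduct_mulVec_nonneg v
  have h2 := hCB.dotProduct_mulVec_nonneg v
  rw [sub_mulVec, dotProduct_sub, sub_nonneg, hCv] at h1 h2
  exact hJ.out (hAJ hs) (hBJ ht)
    ⟨Complex.real_le_real.1 (hs1.trans h1), Complex.real_le_real.1 (h2.trans ht1)⟩

open scoped MatrixOrder in
/-- The direction of Löwner's theorem from divided differences to matrix monotonicity. -/
theorem HasNonnegDividedDifferences.isMatrixMonotoneOn (hF : HasNonnegDividedDifferences N F J)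
    (hJ : IsOpen J) (hJc : J.OrdConnected) (hFc : ContinuousOn F J) : IsMatrixMonotoneOn N F J := by
  classical
  intro A B hA hB hAJ hBJ hAB
  obtain ⟨D, hD⟩ := CStarAlgebra.nonneg_iff_eq_star_mul_self.1 hAB.nonneg
  -- Each row of `D` contributes one rank one term to `Dᴴ * D`.
  set R : Fin N → Matrix (Fin N) (Fin N) ℂ := fun k => vecMulVec (star (D k)) (star (star (D k)))
  have hR : ∀ k, (R k).PosSemidef := fun k => posSemidef_vecMulVec_self_star _
  have hsum : B = A + ∑ k, R k := by
    rw [← sub_eq_iff_eq_add', hD]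
    ext i j
    simp [R, mul_apply, Matrix.sum_apply, vecMulVec_apply]
  have hC : ∀ s : Finset (Fin N), (A + ∑ k ∈ s, R k).IsHermitian := fun s =>
    hA.add (posSemidef_sum s fun k _ => hR k).isHermitian
  have hCJ : ∀ s : Finset (Fin N), spectrum ℝ (A + ∑ k ∈ s, R k) ⊆ J := fun s => by
    refine spectrum_subset_of_posSemidef_sub hJc hA hB (hC s) hAJ hBJ ?_ ?_
    · rw [add_sub_cancel_left]
      exact posSemidef_sum s fun k _ => hR k
    · rw [hsum, ← Finset.sum_add_sum_compl s, ← add_assoc, add_sub_cancel_left]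
      exact posSemidef_sum _ fun k _ => hR k
  refine PosSemidef.of_dotProduct_mulVec_nonneg ?_ fun w => ?_
  · exact IsHermitian.sub (cfc_predicate F B) (cfc_predicate F A)
  rw [sub_mulVec, dotProduct_sub, sub_nonneg, hsum]
  induction (Finset.univ : Finset (Fin N)) using Finset.induction_on with
  | empty => simp
  | insert k s hk ih =>
    refine ih.trans (hF.dotProduct_cfc_le_of_rankOne hJ hFc (hC s) (hCJ s) (hCJ _)
      (c := star (D k)) ?_ w)
    rw [Finset.sum_insert hk, add_comm (R k), ← add_assoc]

end Approximation

/-! ### Lower orders, continuity and intervals. -/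

section Interval

open Filter Topology

variable {N : ℕ} {g : ℝ → ℝ} {I J : Set ℝ}

lemma IsAntiLoewnerOn.of_succ (hI : I.Infinite) (hg : IsAntiLoewnerOn (N + 1) g I) :
    IsAntiLoewnerOn N g I := by
  intro x hx hinj
  obtain ⟨z, hz, hzx⟩ := (hI.sdiff (Set.finite_range x)).nonempty
  exact (hg (Fin.cons z x) (Fin.cases hz hx) (Fin.cons_injective_iff.2 ⟨hzx, hinj⟩)).submatrix
    Fin.succ

lemma IsAntiLoewnerOn.of_le (hI : I.Infinite) {m : ℕ} (hmN : m ≤ N) (hg : IsAntiLoewnerOn N g I) :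
    IsAntiLoewnerOn m g I := by
  induction N, hmN using Nat.le_induction with
  | base => exact hg
  | succ n _ ih => exact ih (hg.of_succ hI)

lemma IsAntiLoewnerOn.nonneg (hI : ∀ x ∈ I, 0 < x) (hg : IsAntiLoewnerOn 1 g I) {x : ℝ}
    (hx : x ∈ I) : 0 ≤ g x := by
  have h := (hg (fun _ => x) (fun _ => hx) (Function.injective_of_subsingleton _)).diag_nonneg
    (i := 0)
  simp only [antiLoewnerMatrix, Matrix.of_apply] at h
  have := hI x hx
  rw [← two_mul, ← two_mul, mul_div_mul_left _ _ two_ne_zero] at h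
  simpa [this.ne'] using mul_nonneg h this.le

/-- With `r = 1` and two nodes this is the ordinary difference quotient. -/
lemma HasNonnegDividedDifferences.monotoneOn {F : ℝ → ℝ} (hF : HasNonnegDividedDifferences 1 F J) :
    MonotoneOn F J := by
  intro s hs t ht hst
  rcases hst.eq_or_lt with rfl | hlt
  · exact le_rfl
  have h := hF (Sum.elim (fun _ => s) (fun _ => t)) (by rintro (i | i); exacts [hs, ht])
    (Function.Injective.sumElim (Function.injective_of_subsingleton _)
      (Function.injective_of_subsingleton _) fun _ _ => hlt.ne) 1
    (by rw [Polynomial.degree_one]; exact Nat.cast_lt.2 one_pos)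
  rw [Fintype.sum_sum_type] at h
  simp only [nodalWeight_sumElim_inl, nodalWeight_sumElim_inr, Sum.elim_inl, Sum.elim_inr] at h
  simp only [Polynomial.eval_one, one_pow, mul_one, Finset.univ_unique, Fin.default_eq_zero,
    Finset.sum_singleton, Finset.prod_singleton, Finset.erase_singleton, Finset.prod_empty, inv_one,
    one_mul] at h
  rw [← neg_sub t s, inv_neg, mul_neg, neg_add_eq_sub, ← sub_mul] at h
  exact sub_nonneg.1 (nonneg_of_mul_nonneg_left h (inv_pos.2 (sub_pos.2 hlt)))

/-- On either side of `t₀`, `f t` is squeezed between `f t₀` and `t * h t₀`, which agree at `t₀`. -/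
lemma continuousOn_of_monotoneOn_of_antitoneOn {f h : ℝ → ℝ} (hJ : IsOpen J)
    (hf : MonotoneOn f J) (hh : AntitoneOn h J) (hpos : ∀ t ∈ J, 0 < t)
    (hfh : ∀ t ∈ J, f t = t * h t) : ContinuousOn f J := by
  intro t₀ ht₀
  refine ContinuousAt.continuousWithinAt ?_
  have h1 : Tendsto (fun t => min (f t₀) (t * h t₀)) (𝓝 t₀) (𝓝 (f t₀)) := by
    have : Continuous fun t => min (f t₀) (t * h t₀) := by fun_prop
    simpa [← hfh t₀ ht₀] using this.tendsto t₀
  have h2 : Tendsto (fun t => max (f t₀) (t * h t₀)) (𝓝 t₀) (𝓝 (f t₀)) := by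
    have : Continuous fun t => max (f t₀) (t * h t₀) := by fun_prop
    simpa [← hfh t₀ ht₀] using this.tendsto t₀
  refine tendsto_of_tendsto_of_tendsto_of_le_of_le' h1 h2 ?_ ?_
  · filter_upwards [hJ.mem_nhds ht₀] with t ht
    rcases le_total t t₀ with hle | hle
    · refine (min_le_right _ _).trans ?_
      rw [hfh t ht]
      exact mul_le_mul_of_nonneg_left (hh ht ht₀ hle) (hpos t ht).le
    · exact (min_le_left _ _).trans (hf ht₀ ht hle)
  · filter_upwards [hJ.mem_nhds ht₀] with t ht
    rcases le_total t t₀ with hle | hle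
    · exact (hf ht ht₀ hle).trans (le_max_left _ _)
    · refine le_trans ?_ (le_max_right _ _)
      rw [hfh t ht]
      exact mul_le_mul_of_nonneg_left (hh ht₀ ht hle) (hpos t ht).le

lemma isOpen_openInterval (a : ℝ) (b : EReal) : IsOpen (openInterval a b) :=
  isOpen_Ioi.inter (isOpen_Iio.preimage continuous_coe_real_ereal)

lemma ordConnected_openInterval (a : ℝ) (b : EReal) : (openInterval a b).OrdConnected :=
  ⟨fun _ hx _ hy _ hz => ⟨hx.1.trans_le hz.1, (EReal.coe_le_coe_iff.2 hz.2).trans_lt hy.2⟩⟩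

lemma infinite_openInterval {a : ℝ} {b : EReal} (hab : (a : EReal) < b) :
    (openInterval a b).Infinite := by
  obtain ⟨c, hac, hcb⟩ := EReal.lt_iff_exists_real_btwn.1 hab
  exact (Set.Ioo_infinite (EReal.coe_lt_coe_iff.1 hac)).mono fun x hx =>
    ⟨hx.1, (EReal.coe_lt_coe_iff.2 hx.2).trans hcb⟩

lemma sqrt_mem_openInterval {a : ℝ} {b : EReal} (ha : 0 ≤ a) (hab : (a : EReal) < b) {x : ℝ}
    (hx : x ∈ openInterval (a ^ 2) (b ^ 2)) : 0 < x ∧ √x ∈ openInterval a b := by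
  obtain ⟨h1, h2⟩ := hx
  refine ⟨(sq_nonneg a).trans_lt h1, (Real.lt_sqrt ha).2 h1, ?_⟩
  induction b with
  | bot => exact absurd hab not_lt_bot
  | top => exact EReal.coe_lt_top _
  | coe b =>
    rw [← EReal.coe_pow, EReal.coe_lt_coe_iff] at h2
    rw [EReal.coe_lt_coe_iff] at hab ⊢
    exact (Real.sqrt_lt' (ha.trans_lt hab)).2 h2

end Interval

theorem theorem1 (a : ℝ) (b : EReal) (ha : 0 ≤ a) (hab : (a : EReal) < b)
    (N : ℕ) (hN : 2 ≤ N) (g : ℝ → ℝ)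
    (hg : IsAntiLoewnerOn (2 * N) g (openInterval a b)) :
    ((∀ x ∈ openInterval (a ^ 2) (b ^ 2), 0 ≤ Real.sqrt x * g (Real.sqrt x)) ∧
      IsMatrixMonotoneOn N (fun x => Real.sqrt x * g (Real.sqrt x))
        (openInterval (a ^ 2) (b ^ 2))) ∧
    ((∀ x ∈ openInterval (a ^ 2) (b ^ 2), 0 ≤ g (Real.sqrt x) / Real.sqrt x) ∧
      IsMatrixAntitoneOn N (fun x => g (Real.sqrt x) / Real.sqrt x)
        (openInterval (a ^ 2) (b ^ 2))) := by
  have hI : ∀ x ∈ openInterval a b, 0 < x := fun x hx => ha.trans_lt hx.1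
  have hJ : ∀ x ∈ openInterval (a ^ 2) (b ^ 2), 0 < x ∧ √x ∈ openInterval a b := fun x hx =>
    sqrt_mem_openInterval ha hab hx
  have hinf := infinite_openInterval hab
  have hg1 : IsAntiLoewnerOn 1 g (openInterval a b) := hg.of_le hinf (by omega)
  have hg2 : IsAntiLoewnerOn (2 * 1) g (openInterval a b) := hg.of_le hinf (by omega)
  have hopen := isOpen_openInterval (a ^ 2) (b ^ 2)
  have hord := ordConnected_openInterval (a ^ 2) (b ^ 2)
  have hcont : ContinuousOn (fun x => √x * g √x) (openInterval (a ^ 2) (b ^ 2)) := by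
    refine continuousOn_of_monotoneOn_of_antitoneOn (h := fun x => g √x / √x) hopen
      (hg2.hasNonnegDividedDifferences_mul_sqrt hI hJ).monotoneOn
      (fun x hx y hy hxy => neg_le_neg_iff.1
        ((hg2.hasNonnegDividedDifferences_neg_div_sqrt hI hJ).monotoneOn hx hy hxy))
      (fun x hx => (hJ x hx).1) fun x hx => ?_
    have h0 := Real.sqrt_pos.2 (hJ x hx).1
    nth_rewrite 3 [← Real.sq_sqrt (hJ x hx).1.le]
    field_simp
  have hcont' : ContinuousOn (fun x => -(g √x / √x)) (openInterval (a ^ 2) (b ^ 2)) := by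
    refine ((hcont.div continuousOn_id fun x hx => (hJ x hx).1.ne').neg).congr fun x hx => ?_
    have h0 := Real.sqrt_pos.2 (hJ x hx).1
    simp only [id, Pi.neg_apply, Pi.div_apply]
    rw [neg_inj, div_eq_div_iff h0.ne' (hJ x hx).1.ne']
    linear_combination (-g √x) * Real.mul_self_sqrt (hJ x hx).1.le
  refine ⟨⟨fun x hx => mul_nonneg (Real.sqrt_nonneg _) (hg1.nonneg hI (hJ x hx).2),
    (hg.hasNonnegDividedDifferences_mul_sqrt hI hJ).isMatrixMonotoneOn hopen hord hcont⟩,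
    fun x hx => div_nonneg (hg1.nonneg hI (hJ x hx).2) (Real.sqrt_nonneg _), ?_⟩
  intro A B hA hB hAJ hBJ hAB
  -- Antitonicity is monotonicity of the negative.
  have h := (hg.hasNonnegDividedDifferences_neg_div_sqrt hI hJ).isMatrixMonotoneOn hopen hord hcont'
    A B hA hB hAJ hBJ hAB
  rwa [cfc_neg, cfc_neg, neg_sub_neg] at h
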